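/- All homology is singular homology with integer coefficients. Spaces are arbitrary topological spaces; smooth complex algebraic varieties with their classical topology are a special case. \textbf{Enumerative problems.} Let $T$ be a path-connected space, $C$ a connected space, and let $U\subset T\times C$ be an enumerative problem of degree $d\ge 0$, i.e. the projection $c:U\to C$ is a covering all of whose fibres have exactly $d$ points. Let $t:U\to T$ be the other projection. Fix $f\in C$ and put $S=c^{-1}(f)$. The Galois group $G\subset\mathfrak S(S)$ is the monodromy group of $c$, i.e. the image of $\pi_1(C,f)\to\mathfrak S(S)$. A \emph{ranking} is a bijection $\delta:S\to\{1,\dots,d\}$. If $\gamma$ is a loop in $C$ based at $f$ whose induced permutation of $S$ is the identity, each $s\in S$ determines a closed lift $\Gamma_s$ of $\gamma$ to $U$ starting at $s$, and $\gamma_\delta\in H_1(T)^d$ is the vector whose $\delta(s)$-th coordinate is the class of the loop $t\circ\Gamma_s$. The \emph{solution lattice} $H_\delta\subset H_1(T)^d$ is the set of all such vectors $\gamma_\delta$. \textbf{Coverings.} Let $\tilde T$ be path-connected and let $\phi:\tilde T\to T$ be a Galois covering (its group $D$ of deck transformations acts transitively on each fibre) which is \emph{strongly inductive}: $\phi_*$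 maps the commutator subgroup of $\pi_1(\tilde T)$ isomorphically onto that of $\pi_1(T)$, and maps the torsion subgroup of $H_1(\tilde T)$ isomorphically onto that of $H_1(T)$. The \emph{$\phi$-wreath problem} is $\tilde U=(\phi\times\mathrm{id})^{-1}(U)\subset\tilde T\times C$, with projection $\tilde U\to C$, which is again a covering; let $\tilde S$ be its fibre over $f$ and $\tilde G\subset\mathfrak S(\tilde S)$ its Galois (monodromy) group. \textbf{Wreath product.} $D\wr G$ is the group of all permutations $\sigma$ of $D\times S$ of the form $\sigma(k,s)=(h_s k,\,g(s))$ with $g\in G$ and $h_s\in D$ for $s\in S$. Any choice of points $\tau(s)\in\phi^{-1}(t(s))$, $s\in S$, gives a bijection $D\times S\to\tilde S$, $(h,s)\mapsto (h(\tau(s)),f)$, by means of which $D\wr G$ is regarded as a subgroup of $\mathfrak S(\tilde S)$. \textbf{Theorem.} For every $f$ and every choice of $\tau$, the equality $\tilde G=D\wr G$ of subgroups of $\mathfrak S(\tilde S)$ holds if and only if $$H_1(T)^d=H_\delta+\phi_*H_1(\tilde T)^d$$ for some ranking $\delta$, and also if and only if this holds for every ranking $\delta$. -/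

import Mathlib

universe u v

namespace WreathGalois

open CategoryTheory AlgebraicTopology Topology

noncomputable section

/-! ### First singular homology with integer coefficients -/

/-- The first singular homology group `H₁(X)` of a topological space, with integer coefficients. -/
abbrev H1 (X : Type u) [TopologicalSpace X] : AddCommGrpCat.{u} :=
  ((singularHomologyFunctor AddCommGrpCat.{u} 1).obj (AddCommGrpCat.of (ULift.{u} ℤ))).obj
    (TopCat.of X)

/-- The homomorphism `f_* : H₁(X) → H₁(Y)` induced by a continuous map. -/
def H1map {X Y : Type u} [TopologicalSpace X] [TopologicalSpace Y] (f : C(X, Y)) :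
    H1 X →+ H1 Y :=
  (((singularHomologyFunctor AddCommGrpCat.{u} 1).obj (AddCommGrpCat.of (ULift.{u} ℤ))).map
    (TopCat.ofHom f)).hom

/-- A path, seen as a singular `1`-simplex through `Δ¹ ≃ [0,1]`. -/
def pathSimplex {X : Type u} [TopologicalSpace X] {x y : X} (γ : Path x y) :
    (TopCat.toSSet.obj (TopCat.of X)).obj (Opposite.op (SimplexCategory.mk 1)) :=
  ((TopCat.of X).toSSetObjEquiv _).symm
    (γ.toContinuousMap.comp (toContinuousMap stdSimplexHomeomorphUnitInterval))

/-- A loop is a singular `1`-cycle: its two faces agree. -/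
theorem loop_d_eq_zero {X : Type u} [TopologicalSpace X] {x : X} (γ : Path x x) :
    SSet.ιChainComplex (R := AddCommGrpCat.of (ULift.{u} ℤ)) _ (pathSimplex γ) ≫
      ((TopCat.toSSet.obj (TopCat.of X)).chainComplex (AddCommGrpCat.of (ULift.{u} ℤ))).d 1 0
      = 0 := by
  have h : (TopCat.toSSet.obj (TopCat.of X)).δ 0 (pathSimplex γ) =
      (TopCat.toSSet.obj (TopCat.of X)).δ 1 (pathSimplex γ) := by
    apply ((TopCat.of X).toSSetObjEquiv _).injective
    ext z
    obtain rfl : z = stdSimplex.vertex 0 := Subsingleton.elim (α := stdSimplex ℝ (Fin 1)) _ _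
    change γ (stdSimplexHomeomorphUnitInterval (stdSimplex.map (Fin.succAbove 0)
      (stdSimplex.vertex 0)))=
      γ (stdSimplexHomeomorphUnitInterval (stdSimplex.map (Fin.succAbove 1)
      (stdSimplex.vertex 0)))
    rw [stdSimplex.map_vertex, stdSimplex.map_vertex]
    exact γ.target.trans γ.source.symm
  simp [h]

/-- The class in `H₁(X)` of the singular cycle given by a loop. -/
def loopClass {X : Type u} [TopologicalSpace X] {x : X} (γ : Path x x) : H1 X :=
  (((TopCat.toSSet.obj (TopCat.of X)).chainComplex (AddCommGrpCat.of (ULift.{u} ℤ))).liftCycles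
      (SSet.ιChainComplex _ (pathSimplex γ)) 0 (by simp) (loop_d_eq_zero γ) ≫
    ((TopCat.toSSet.obj (TopCat.of X)).chainComplex
      (AddCommGrpCat.of (ULift.{u} ℤ))).homologyπ 1).hom (ULift.up 1)

/-! ### Coverings: products with the identity, and composition with a finite covering -/

/-- An evenly covered point has an open neighbourhood whose preimage is split into sheets. -/
theorem exists_sheets {E X I : Type*} [TopologicalSpace E] [TopologicalSpace X]
    [TopologicalSpace I] {p : E → X} {x : X} (h : IsEvenlyCovered p x I) :
    ∃ W : Set X, IsOpen W ∧ x ∈ W ∧ ∃ B : I → Set E, (∀ j, IsOpen (B j)) ∧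
      (∀ i j e, e ∈ B i → e ∈ B j → i = j) ∧ (∀ j, (B j).InjOn p) ∧ (∀ j, p '' B j = W) ∧
      ∀ e, p e ∈ W → ∃ j, e ∈ B j := by
  obtain ⟨hd, W, hx, hW, hpW, H, hH⟩ := h
  refine ⟨W, hW, hx, fun j ↦ Subtype.val '' {e : p ⁻¹' W | (H e).2 = j}, fun j ↦ ?_, ?_, ?_, ?_, ?_⟩
  · refine hpW.isOpenMap_subtype_val _ ?_
    exact (isOpen_discrete {j}).preimage (continuous_snd.comp H.continuous)
  · rintro i j e ⟨a, ha, rfl⟩ ⟨b, hb, hab⟩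
    obtain rfl := Subtype.ext hab
    exact ha.symm.trans hb
  · rintro j _ ⟨a, ha, rfl⟩ _ ⟨b, hb, rfl⟩ hab
    refine congrArg Subtype.val (H.injective (Prod.ext (Subtype.ext ?_) (ha.trans hb.symm)))
    rw [hH, hH, hab]
  · intro j
    ext w
    constructor
    · rintro ⟨_, ⟨a, -, rfl⟩, rfl⟩
      exact a.2
    · intro hw
      refine ⟨_, ⟨H.symm (⟨w, hw⟩, j), by simp, rfl⟩, ?_⟩
      rw [← hH]
      simp
  · intro e he
    exact ⟨_, ⟨e, he⟩, rfl, rfl⟩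

/-- Conversely, a point is evenly covered if a neighbourhood splits into sheets. -/
theorem isEvenlyCovered_of_sheets {E X I : Type*} [TopologicalSpace E] [TopologicalSpace X]
    {p : E → X} (hc : Continuous p) (ho : IsOpenMap p) {x : X} {W : Set X} (hW : IsOpen W)
    (hx : x ∈ W) (B : I → Set E) (hB : ∀ j, IsOpen (B j))
    (hdisj : ∀ i j e, e ∈ B i → e ∈ B j → i = j) (hinj : ∀ j, (B j).InjOn p)
    (hsurj : ∀ j, W ⊆ p '' B j) (hex : ∀ e, p e ∈ W → ∃ j, e ∈ B j) :
    IsEvenlyCovered p x (p ⁻¹' {x}) := by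
  rcases isEmpty_or_nonempty I with hI | ⟨⟨i⟩⟩
  · have hemp : p ⁻¹' W = ∅ := by
      ext e
      simp only [Set.mem_preimage, Set.mem_empty_iff_false, iff_false]
      intro he
      exact hI.elim (hex e he).choose
    exact (IsEvenlyCovered.of_preimage_eq_empty PEmpty.{1} (hW.mem_nhds hx)
      hemp).to_isEvenlyCovered_preimage
  · obtain ⟨e, -, -⟩ := hsurj i hx
    have : Nonempty (X → E) := ⟨fun _ ↦ e⟩
    have : Nonempty I := ⟨i⟩
    let _ : TopologicalSpace I := ⊥
    have : DiscreteTopology I := ⟨rfl⟩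
    refine (IsEvenlyCovered.of_trivialization (t := IsOpen.trivializationDiscrete (f := p) B W hW
      (fun j V hV ↦ ⟨fun h ↦ (h.preimage hc).inter (hB j), fun h ↦ ?_⟩) hinj hsurj ?_ ?_)
      hx).to_isEvenlyCovered_preimage
    · convert ho _ h using 1
      ext v
      constructor
      · intro hv
        obtain ⟨e, he, rfl⟩ := hsurj j (hV hv)
        exact ⟨e, ⟨hv, he⟩, rfl⟩
      · rintro ⟨e, ⟨he, -⟩, rfl⟩
        exact he
    · intro a b hab
      exact Set.disjoint_left.2 fun e ha hb ↦ hab (hdisj a b e ha hb)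
    · intro e he
      exact Set.mem_iUnion.2 (hex e he)

/-- The product of a covering with the identity of a space is a covering. -/
theorem isCoveringMap_prodMap_id {E X C : Type*} [TopologicalSpace E] [TopologicalSpace X]
    [TopologicalSpace C] {p : E → X} (hp : IsCoveringMap p) :
    IsCoveringMap (Prod.map p (id : C → C)) := by
  rintro ⟨x, c⟩
  obtain ⟨W, hW, hx, B, hB, hdisj, hinj, himg, hex⟩ := exists_sheets (hp x)
  refine isEvenlyCovered_of_sheets (hp.continuous.prodMap continuous_id)
    (hp.isOpenMap.prodMap IsOpenMap.id) (W := W ×ˢ Set.univ) (hW.prod isOpen_univ) ⟨hx, trivial⟩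
    (fun j ↦ B j ×ˢ Set.univ) (fun j ↦ (hB j).prod isOpen_univ) ?_ ?_ ?_ ?_
  · rintro i j ⟨e, c⟩ ⟨hi, -⟩ ⟨hj, -⟩
    exact hdisj i j e hi hj
  · rintro j ⟨e, c⟩ ⟨he, -⟩ ⟨e', c'⟩ ⟨he', -⟩ h
    simp only [Prod.map_apply, id_eq, Prod.mk.injEq] at h ⊢
    exact ⟨hinj j he he' h.1, h.2⟩
  · rintro j ⟨w, c⟩ ⟨hw, -⟩
    rw [← himg j] at hw
    obtain ⟨e, he, rfl⟩ := hw
    exact ⟨(e, c), ⟨he, trivial⟩, rfl⟩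
  · rintro ⟨e, c⟩ ⟨he, -⟩
    obtain ⟨j, hj⟩ := hex e he
    exact ⟨j, hj, trivial⟩

/-- The composition of a covering with a covering with finite fibres is a covering. -/
theorem isCoveringMap_comp {E Y X : Type*} [TopologicalSpace E] [TopologicalSpace Y]
    [TopologicalSpace X] {g : E → Y} {p : Y → X} (hg : IsCoveringMap g) (hp : IsCoveringMap p)
    (hfin : ∀ x, (p ⁻¹' {x}).Finite) : IsCoveringMap (p ∘ g) := by
  intro x
  obtain ⟨V, hV, hx, A, hA, hAdisj, hAinj, hAimg, hAex⟩ := exists_sheets (hp x)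
  have : Finite (p ⁻¹' {x}) := hfin x
  have hpt : ∀ i : p ⁻¹' {x}, ∃ y, y ∈ A i ∧ p y = x := fun i ↦ by
    have := hx
    rw [← hAimg i] at this
    exact this
  choose y hyA hyx using hpt
  choose W hW hyW B hB hBdisj hBinj hBimg hBex using fun i ↦ exists_sheets (hg (y i))
  refine isEvenlyCovered_of_sheets (hp.continuous.comp hg.continuous)
    (hp.isOpenMap.comp hg.isOpenMap) (W := V ∩ ⋂ i, p '' (A i ∩ W i))
    (hV.inter (isOpen_iInter_of_finite fun i ↦ hp.isOpenMap _ ((hA i).inter (hW i))))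
    ⟨hx, Set.mem_iInter.2 fun i ↦ ⟨y i, ⟨hyA i, hyW i⟩, hyx i⟩⟩
    (fun ij : (i : p ⁻¹' {x}) × (g ⁻¹' {y i}) ↦ B ij.1 ij.2 ∩ g ⁻¹' A ij.1)
    (fun ij ↦ (hB _ _).inter ((hA _).preimage hg.continuous)) ?_ ?_ ?_ ?_
  · rintro ⟨i, j⟩ ⟨i', j'⟩ e ⟨h1, h2⟩ ⟨h1', h2'⟩
    obtain rfl := hAdisj i i' (g e) h2 h2'
    obtain rfl := hBdisj i j j' e h1 h1'
    rfl
  · rintro ⟨i, j⟩ e ⟨h1, h2⟩ e' ⟨h1', h2'⟩ h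
    exact hBinj i j h1 h1' (hAinj i h2 h2' h)
  · rintro ⟨i, j⟩ v ⟨-, hv⟩
    obtain ⟨z, ⟨hzA, hzW⟩, rfl⟩ := Set.mem_iInter.1 hv i
    rw [← hBimg i j] at hzW
    obtain ⟨e, he, rfl⟩ := hzW
    exact ⟨e, ⟨he, hzA⟩, rfl⟩
  · rintro e ⟨heV, he⟩
    obtain ⟨i, hi⟩ := hAex (g e) heV
    obtain ⟨z, ⟨hzA, hzW⟩, hz⟩ := Set.mem_iInter.1 he i
    obtain rfl := hAinj i hzA hi hz
    obtain ⟨j, hj⟩ := hBex i e hzW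
    exact ⟨⟨i, j⟩, hj, hi⟩

/-! ### Enumerative problems -/

/-- The projection `c : U → C` of a solution space `U ⊆ T × C` to the space of conditions. -/
def conditionMap {T C : Type*} (U : Set (T × C)) (u : U) : C := u.1.2

/-- The projection `t : U → T` of a solution space `U ⊆ T × C` to the ambient space. -/
def ambientMap {T C : Type*} (U : Set (T × C)) (u : U) : T := u.1.1

theorem continuous_ambientMap {T C : Type*} [TopologicalSpace T] [TopologicalSpace C]
    (U : Set (T × C)) : Continuous (ambientMap U) :=
  continuous_fst.comp continuous_subtype_val

/-- The set `S = c⁻¹(f)` of solutions for the condition `f`. -/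
abbrev Solutions {T C : Type*} (U : Set (T × C)) (f : C) : Set U := conditionMap U ⁻¹' {f}

/-- `U ⊆ T × C` is (the solution space of) an enumerative problem of degree `d`: the projection
`U → C` is a covering all of whose fibres have exactly `d` elements. -/
structure IsEnumerativeProblem {T C : Type*} [TopologicalSpace T] [TopologicalSpace C]
    (U : Set (T × C)) (d : ℕ) : Prop where
  isCoveringMap : IsCoveringMap (conditionMap U)
  encard_solutions : ∀ f, (Solutions U f).encard = d

/-- The Galois (monodromy) group of an enumerative problem with base point `f`: the image of
`π₁(C, f)` in the group of permutations of the set of solutions over `f`. -/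
def galoisGroup {T C : Type*} [TopologicalSpace T] [TopologicalSpace C] {U : Set (T × C)}
    (hU : IsCoveringMap (conditionMap U)) (f : C) : Subgroup (Equiv.Perm (Solutions U f)) :=
  (hU.monodromyPerm f).range

/-- The solution space `Ũ ⊆ T̃ × C` of the `φ`-wreath problem over `U ⊆ T × C`: the preimage of `U`
under `(φ, id)`. -/
def wreathSpace {T T' C : Type*} (φ : T' → T) (U : Set (T × C)) : Set (T' × C) :=
  Prod.map φ id ⁻¹' U

/-- The projection from the solution space of the `φ`-wreath problem to `C` is a covering. -/
theorem isCoveringMap_wreathSpace {T T' C : Type*} [TopologicalSpace T] [TopologicalSpace T']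
    [TopologicalSpace C] {φ : T' → T} (hφ : IsCoveringMap φ) {U : Set (T × C)} {d : ℕ}
    (hU : IsEnumerativeProblem U d) : IsCoveringMap (conditionMap (wreathSpace φ U)) :=
  isCoveringMap_comp (p := conditionMap U) ((isCoveringMap_prodMap_id hφ).restrictPreimage U)
    hU.isCoveringMap fun f ↦ Set.finite_of_encard_eq_coe (hU.encard_solutions f)

/-- The solution lattice `H_δ ⊆ H₁(T)^d` of a ranking `δ : S → {1, …, d}`: the set of all vectors
`γ_δ`, where `γ` is a loop in `C` based at `f` all of whose lifts `Γ_s` to `U`, `s ∈ S`, are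
closed, and the coordinate of `γ_δ` with index `δ(s)` is the class of the loop `t ∘ Γ_s`. -/
def solutionLattice {T : Type u} {C : Type v} [TopologicalSpace T] [TopologicalSpace C]
    (U : Set (T × C)) {f : C} {d : ℕ} (δ : Solutions U f ≃ Fin d) : Set (Fin d → H1 T) :=
  {w | ∃ (γ : Path f f) (Γ : ∀ s : Solutions U f, Path s.1 s.1),
    (∀ s r, conditionMap U (Γ s r) = γ r) ∧
      ∀ s, w (δ s) = loopClass ((Γ s).map (continuous_ambientMap U))}

/-! ### Galois, inductive and strongly inductive coverings -/

/-- The group of deck transformations of `φ : X → Y`. -/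
def deckGroup {X Y : Type*} [TopologicalSpace X] (φ : X → Y) : Subgroup (X ≃ₜ X) where
  carrier := {h | ∀ x, φ (h x) = φ x}
  mul_mem' {a b} ha hb x := by rw [Homeomorph.mul_apply, ha, hb]
  one_mem' _ := rfl
  inv_mem' {a} ha x := by
    rw [← ha (a⁻¹ x), Homeomorph.inv_apply, Homeomorph.apply_symm_apply]

/-- A covering is Galois if its deck transformations act transitively on every fibre. -/
structure IsGaloisCovering {X Y : Type*} [TopologicalSpace X] [TopologicalSpace Y]
    (φ : X → Y) : Prop where
  isCoveringMap : IsCoveringMap φ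
  exists_deck : ∀ x x', φ x = φ x' → ∃ h ∈ deckGroup φ, h x = x'

/-- A covering of path-connected spaces is inductive if it induces an isomorphism between the
commutator subgroups of the fundamental groups. -/
structure IsInductive {X Y : Type*} [TopologicalSpace X] [TopologicalSpace Y]
    [PathConnectedSpace X] [PathConnectedSpace Y] (φ : C(X, Y)) : Prop where
  isCoveringMap : IsCoveringMap φ
  bijOn_commutator : ∀ x, Set.BijOn (FundamentalGroup.map φ x)
    (commutator (FundamentalGroup X x)) (commutator (FundamentalGroup Y (φ x)))

/-- An inductive covering is strongly inductive if it induces an isomorphism between the torsion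
subgroups of the first homology groups. -/
structure IsStronglyInductive {X Y : Type u} [TopologicalSpace X] [TopologicalSpace Y]
    [PathConnectedSpace X] [PathConnectedSpace Y] (φ : C(X, Y)) : Prop extends
    IsInductive φ where
  bijOn_torsion : Set.BijOn (H1map φ) (AddCommGroup.torsion (H1 X)) (AddCommGroup.torsion (H1 Y))

/-! ### Wreath products -/

/-- The wreath product `H ≀ G` of a group `H` and a permutation group `G` of `S`, as the group of
permutations `σ` of `H × S` that cover a permutation `g ∈ G` of `S` and map each `H × {s}` to
`H × {g s}` by the multiplication by an element of `H`. -/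
def wreathProduct (H : Type*) [Group H] {S : Type*} (G : Subgroup (Equiv.Perm S)) :
    Subgroup (Equiv.Perm (H × S)) where
  carrier := {σ | ∃ g ∈ G, ∃ h : S → H, ∀ k s, σ (k, s) = (h s * k, g s)}
  mul_mem' := by
    rintro σ σ' ⟨g, hg, h, hσ⟩ ⟨g', hg', h', hσ'⟩
    exact ⟨g * g', G.mul_mem hg hg', fun s ↦ h (g' s) * h' s, fun k s ↦ by
      rw [Equiv.Perm.mul_apply, hσ', hσ, mul_assoc, Equiv.Perm.mul_apply]⟩
  one_mem' := ⟨1, G.one_mem, fun _ ↦ 1, fun k s ↦ by simp⟩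
  inv_mem' := by
    rintro σ ⟨g, hg, h, hσ⟩
    refine ⟨g⁻¹, G.inv_mem hg, fun s ↦ (h (g⁻¹ s))⁻¹, fun k s ↦ ?_⟩
    rw [Equiv.Perm.inv_eq_iff_eq, hσ]
    simp

/-- For a Galois covering `φ` with deck group `D` and a choice `τ` of a preimage `τ(s) ∈ T̃` of each
solution `s ∈ S`, the bijection `D × S ≃ S̃`, `(h, s) ↦ h(τ(s))`, onto the set of solutions of the
`φ`-wreath problem. -/
def wreathSolutionsEquiv {T T' C : Type*} [TopologicalSpace T] [TopologicalSpace T']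
    [PathConnectedSpace T'] {φ : T' → T} (hφ : IsGaloisCovering φ) {U : Set (T × C)} {f : C}
    (τ : ∀ s : Solutions U f, φ ⁻¹' {ambientMap U s}) :
    deckGroup φ × Solutions U f ≃ Solutions (wreathSpace φ U) f :=
  Equiv.ofBijective
    (fun hs ↦ ⟨⟨(hs.1.1 (τ hs.2), f), by
      have h1 : φ (hs.1.1 (τ hs.2)) = hs.2.1.1.1 := (hs.1.2 _).trans (τ hs.2).2
      have h2 : f = hs.2.1.1.2 := hs.2.2.symm
      have h3 : (φ (hs.1.1 (τ hs.2)), f) = hs.2.1.1 := Prod.ext h1 h2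
      change (φ (hs.1.1 (τ hs.2)), f) ∈ U
      exact h3 ▸ hs.2.1.2⟩, rfl⟩) <| by
    constructor
    · rintro ⟨⟨h, hh⟩, s⟩ ⟨⟨h', hh'⟩, s'⟩ e
      have e1 : h (τ s) = h' (τ s') := congrArg (fun z ↦ z.1.1.1) e
      have e2 : s = s' := by
        apply Subtype.ext
        apply Subtype.ext
        refine Prod.ext ?_ (s.2.trans s'.2.symm)
        have h1 : φ (h (τ s)) = s.1.1.1 := (hh _).trans (τ s).2
        have h2 : φ (h' (τ s')) = s'.1.1.1 := (hh' _).trans (τ s').2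
        rw [← h1, ← h2, e1]
      subst e2
      have e3 : h = h' := by
        apply Homeomorph.ext
        exact congrFun (hφ.isCoveringMap.eq_of_comp_eq h.continuous h'.continuous
          (funext fun x ↦ (hh x).trans (hh' x).symm) (τ s).1 e1)
      subst e3
      rfl
    · rintro ⟨⟨⟨y, c⟩, hy⟩, hc⟩
      obtain rfl : c = f := hc
      obtain ⟨h, hh, hhy⟩ := hφ.exists_deck (τ ⟨⟨(φ y, c), hy⟩, rfl⟩) y (τ ⟨⟨(φ y, c), hy⟩, rfl⟩).2
      refine ⟨⟨⟨h, hh⟩, ⟨⟨(φ y, c), hy⟩, rfl⟩⟩, ?_⟩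
      apply Subtype.ext
      apply Subtype.ext
      exact Prod.ext hhy rfl

end

end WreathGalois

/-!
Write `D` for the deck group of `φ`. A commutator in `π₁(T)` comes from `π₁(T')`, so it lifts to a
loop in `T'`, and hence `D` is abelian (`IsGaloisCovering.deckGroup_mul_comm`). Each path in `T` has
a value in `D`: its lift starts at a chosen point of one fibre and ends at a translate of a chosen
point of another one. As `D` is abelian, these values are additive, so they define a homomorphism
`Φ : H₁(T) → D`, which sends the class of a loop to its monodromy
(`IsGaloisCovering.exists_deckHom`). It is surjective, and its kernel is `φ_* H₁(T')`
(`IsGaloisCovering.deckHom_eq_zero_iff`). The kernel is computed with one general fact on singular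
homology: in a path-connected space, every class in `H₁` is the class of a loop
(`loopClass_surjective`). The kernel of the Hurewicz homomorphism is not needed.

Along a loop `γ` in `C`, the monodromy of the wreath problem is that of `φ` along the images in `T`
of the lifts of `γ` to `U` (`monodromy_wreathSolution`). So it lies in `D ≀ G`, and since it covers
all of `G`, the Galois group of the wreath problem is `D ≀ G` if and only if it contains `D^S`
(`galoisGroup_eq_wreathProduct_iff`). A loop whose lifts to `U` are closed acts on `D × S` as the
element of `D^S` obtained from its vector in `H₁(T)^d` by applying `Φ` to the coordinates. Hence
the Galois group contains `D^S` if and only if `Φ^d` maps the solution lattice onto `D^d`, which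
means that the lattice and the kernel `φ_* H₁(T')^d` together fill `H₁(T)^d`
(`solutionLattice_add_range_eq_univ_iff`). This holds for each ranking, and a ranking exists.
-/

namespace WreathGalois

open CategoryTheory AlgebraicTopology Topology

noncomputable section

/-! ### Singular one-chains -/

/-- The singular chain complex of a space, with integer coefficients. -/
abbrev singularChains (X : Type u) [TopologicalSpace X] : ChainComplex AddCommGrpCat.{u} ℕ :=
  (TopCat.toSSet.obj (TopCat.of X)).chainComplex (AddCommGrpCat.of (ULift.{u} ℤ))

/-- The class of a path, seen as a singular `1`-simplex, modulo boundaries. -/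
def edgeClass {X : Type u} [TopologicalSpace X] {x y : X} (γ : Path x y) :
    AddCommGrpCat.of (ULift.{u} ℤ) ⟶ (singularChains X).opcycles 1 :=
  SSet.ιChainComplex _ (pathSimplex γ) ≫ (singularChains X).pOpcycles 1

/-- The homology class of a loop, as a homomorphism from the coefficient group. -/
def loopHom {X : Type u} [TopologicalSpace X] {x : X} (γ : Path x x) :
    AddCommGrpCat.of (ULift.{u} ℤ) ⟶ (singularChains X).homology 1 :=
  (singularChains X).liftCycles (SSet.ιChainComplex _ (pathSimplex γ)) 0 (by simp)
    (loop_d_eq_zero γ) ≫ (singularChains X).homologyπ 1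

theorem loopClass_eq {X : Type u} [TopologicalSpace X] {x : X} (γ : Path x x) :
    loopClass γ = (loopHom γ).hom (ULift.up 1) := rfl

theorem loopHom_homologyι {X : Type u} [TopologicalSpace X] {x : X} (γ : Path x x) :
    loopHom γ ≫ (singularChains X).homologyι 1 = edgeClass γ := by
  simp [loopHom, edgeClass]

/-- The edge of the standard `2`-simplex opposite to a vertex, parametrized from its smaller to its
larger vertex. -/
def triangleEdge (i : Fin 3) : C(unitInterval, stdSimplex ℝ (Fin 3)) where
  toFun t := stdSimplex.map (Fin.succAbove i) (stdSimplexHomeomorphUnitInterval.symm t)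
  continuous_toFun := (stdSimplex.continuous_map _).comp (Homeomorph.continuous _)

/-- A singular `2`-simplex. -/
def triangleSimplex {X : Type u} [TopologicalSpace X] (m : C(stdSimplex ℝ (Fin 3), X)) :
    (TopCat.toSSet.obj (TopCat.of X)).obj (Opposite.op (SimplexCategory.mk 2)) :=
  ((TopCat.of X).toSSetObjEquiv _).symm m

theorem triangleSimplex_δ {X : Type u} [TopologicalSpace X] (m : C(stdSimplex ℝ (Fin 3), X))
    (i : Fin 3) {x y : X} (γ : Path x y) (h : ∀ t, m (triangleEdge i t) = γ t) :
    (TopCat.toSSet.obj (TopCat.of X)).δ i (triangleSimplex m) = pathSimplex γ := by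
  apply ((TopCat.of X).toSSetObjEquiv _).injective
  ext z
  change m (stdSimplex.map (Fin.succAbove i) z) = γ (stdSimplexHomeomorphUnitInterval z)
  rw [← h]
  simp [triangleEdge]

theorem exists_path_simplex {X : Type u} [TopologicalSpace X]
    (s : (TopCat.toSSet.obj (TopCat.of X)).obj (Opposite.op (SimplexCategory.mk 1))) :
    ∃ (x : X) (y : X) (γ : Path x y), s = pathSimplex γ := by
  obtain ⟨m, rfl⟩ := ((TopCat.of X).toSSetObjEquiv _).symm.surjective s
  let m' : C(unitInterval, X) :=
    ContinuousMap.comp (m : C(stdSimplex ℝ (Fin 2), X))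
      (toContinuousMap stdSimplexHomeomorphUnitInterval.symm)
  refine ⟨m' 0, m' 1, ⟨m', rfl, rfl⟩, congrArg _ ?_⟩
  ext z
  exact congrArg m (stdSimplexHomeomorphUnitInterval.symm_apply_apply z).symm

theorem exists_triangleSimplex {X : Type u} [TopologicalSpace X]
    (s : (TopCat.toSSet.obj (TopCat.of X)).obj (Opposite.op (SimplexCategory.mk 2))) :
    ∃ m, s = triangleSimplex m :=
  ⟨_, (Equiv.symm_apply_apply _ s).symm⟩

/-- The three edges of a singular triangle add up to zero modulo boundaries. -/
theorem edgeClass_triangle {X : Type u} [TopologicalSpace X] (m : C(stdSimplex ℝ (Fin 3), X))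
    {x y z x' y' z' : X} (α : Path x y) (β : Path y' z) (γ : Path x' z')
    (hα : ∀ t, m (triangleEdge 2 t) = α t) (hβ : ∀ t, m (triangleEdge 0 t) = β t)
    (hγ : ∀ t, m (triangleEdge 1 t) = γ t) :
    edgeClass γ = edgeClass α + edgeClass β := by
  have h := ((TopCat.toSSet.obj (TopCat.of X)).ιChainComplex_d
    (R := AddCommGrpCat.of (ULift.{u} ℤ)) (triangleSimplex m)).trans (Fin.sum_univ_three _)
  rw [triangleSimplex_δ m 0 β hβ, triangleSimplex_δ m 1 γ hγ, triangleSimplex_δ m 2 α hα] at h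
  have h' := congrArg (· ≫ (singularChains X).pOpcycles 1) h
  simp only [Category.assoc, HomologicalComplex.d_pOpcycles, Limits.comp_zero,
    Preadditive.add_comp] at h'
  have h'' : 0 = edgeClass β + - edgeClass γ + edgeClass α := by
    simpa [edgeClass] using h'
  rw [eq_comm, ← sub_eq_zero, h'']
  abel

theorem stdSimplexHomeomorphUnitInterval_symm_apply_zero (t : unitInterval) :
    stdSimplexHomeomorphUnitInterval.symm t 0 = 1 - (t : ℝ) := rfl

theorem stdSimplexHomeomorphUnitInterval_symm_apply_one (t : unitInterval) :
    stdSimplexHomeomorphUnitInterval.symm t 1 = (t : ℝ) := rfl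

theorem triangleEdge_zero (t : unitInterval) :
    ((triangleEdge 0 t : stdSimplex ℝ (Fin 3)) : Fin 3 → ℝ) = ![0, 1 - (t : ℝ), t] := by
  ext j
  fin_cases j <;>
    simp [triangleEdge, FunOnFinite.linearMap_apply_apply, Finset.sum_filter, Fin.sum_univ_two,
      stdSimplexHomeomorphUnitInterval_symm_apply_zero,
      stdSimplexHomeomorphUnitInterval_symm_apply_one]

theorem triangleEdge_one (t : unitInterval) :
    ((triangleEdge 1 t : stdSimplex ℝ (Fin 3)) : Fin 3 → ℝ) = ![1 - (t : ℝ), 0, t] := by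
  ext j
  fin_cases j <;>
    simp [triangleEdge, FunOnFinite.linearMap_apply_apply, Finset.sum_filter, Fin.sum_univ_two,
      stdSimplexHomeomorphUnitInterval_symm_apply_zero,
      stdSimplexHomeomorphUnitInterval_symm_apply_one]

theorem triangleEdge_two (t : unitInterval) :
    ((triangleEdge 2 t : stdSimplex ℝ (Fin 3)) : Fin 3 → ℝ) = ![1 - (t : ℝ), t, 0] := by
  ext j
  fin_cases j <;>
    simp [triangleEdge, FunOnFinite.linearMap_apply_apply, Finset.sum_filter, Fin.sum_univ_two,
      stdSimplexHomeomorphUnitInterval_symm_apply_zero,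
      stdSimplexHomeomorphUnitInterval_symm_apply_one,
      show Fin.succAbove (2 : Fin 3) 1 = 1 from rfl]

theorem edgeClass_refl {X : Type u} [TopologicalSpace X] (x : X) :
    edgeClass (Path.refl x) = 0 := by
  simpa using edgeClass_triangle (.const _ x) (Path.refl x) (Path.refl x) (Path.refl x)
    (fun _ ↦ rfl) (fun _ ↦ rfl) fun _ ↦ rfl

theorem continuous_stdSimplex_apply {ι : Type*} [Fintype ι] (i : ι) :
    Continuous fun p : stdSimplex ℝ ι ↦ p i :=
  (continuous_apply i).comp continuous_subtype_val

theorem edgeClass_trans {X : Type u} [TopologicalSpace X] {x y z : X} (α : Path x y)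
    (β : Path y z) : edgeClass (α.trans β) = edgeClass α + edgeClass β := by
  -- The triangle is crushed onto its edge from vertex `0` to vertex `2`, with vertex `1` going to
  -- the midpoint of that edge.
  let m : C(stdSimplex ℝ (Fin 3), X) := ⟨fun p ↦ (α.trans β).extend (p 1 / 2 + p 2),
    (α.trans β).continuous_extend.comp
      (((continuous_stdSimplex_apply 1).div_const 2).add (continuous_stdSimplex_apply 2))⟩
  refine edgeClass_triangle m α β (α.trans β) (fun t ↦ ?_) (fun t ↦ ?_) fun t ↦ ?_
  · have : m (triangleEdge 2 t) = (α.trans β).extend ((t : ℝ) / 2) := by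
      simp [m, triangleEdge_two]
    rw [this, Path.extend_trans_of_le_half _ _ (by linarith [t.2.2]), mul_div_cancel₀ _ two_ne_zero,
      Path.extend_extends']
  · have : m (triangleEdge 0 t) = (α.trans β).extend ((1 + t : ℝ) / 2) := by
      simp only [m, triangleEdge_zero, ContinuousMap.coe_mk]
      congr 1
      simp
      ring
    rw [this, Path.extend_trans_of_half_le _ _ (by linarith [t.2.1]), mul_div_cancel₀ _ two_ne_zero,
      add_sub_cancel_left, Path.extend_extends']
  · have : m (triangleEdge 1 t) = (α.trans β).extend t := by
      simp [m, triangleEdge_one]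
    rw [this, Path.extend_extends']

theorem edgeClass_symm {X : Type u} [TopologicalSpace X] {x y : X} (α : Path x y) :
    edgeClass α.symm = - edgeClass α := by
  -- The triangle is crushed onto its edge from vertex `0` to vertex `1`, with vertex `2` going to
  -- vertex `0`.
  let m : C(stdSimplex ℝ (Fin 3), X) := ⟨fun p ↦ α.extend (p 1),
    α.continuous_extend.comp (continuous_stdSimplex_apply 1)⟩
  have h := edgeClass_triangle m α α.symm (Path.refl x) (fun t ↦ ?_) (fun t ↦ ?_) fun t ↦ ?_
  · rw [edgeClass_refl] at h
    exact (neg_eq_of_add_eq_zero_right h.symm).symm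
  · have : m (triangleEdge 2 t) = α.extend t := by simp [m, triangleEdge_two]
    rw [this, Path.extend_extends']
  · have : m (triangleEdge 0 t) = α.extend (1 - t) :=
      congrArg α.extend (congrFun (triangleEdge_zero t) 1)
    rw [this, ← Path.extend_symm_apply, Path.extend_extends']
  · have : m (triangleEdge 1 t) = α.extend 0 := by simp [m, triangleEdge_one]
    rw [this, Path.extend_zero, Path.refl_apply]

/-! ### Loops generate the first homology group -/

theorem loopHom_refl {X : Type u} [TopologicalSpace X] (x : X) : loopHom (Path.refl x) = 0 := by
  rw [← cancel_mono ((singularChains X).homologyι 1), loopHom_homologyι, edgeClass_refl,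
    Limits.zero_comp]

theorem loopHom_trans {X : Type u} [TopologicalSpace X] {x : X} (α β : Path x x) :
    loopHom (α.trans β) = loopHom α + loopHom β := by
  rw [← cancel_mono ((singularChains X).homologyι 1), Preadditive.add_comp]
  simp only [loopHom_homologyι, edgeClass_trans]

theorem loopHom_symm {X : Type u} [TopologicalSpace X] {x : X} (α : Path x x) :
    loopHom α.symm = - loopHom α := by
  rw [← cancel_mono ((singularChains X).homologyι 1), Preadditive.neg_comp]
  simp only [loopHom_homologyι, edgeClass_symm]

/-- The homology classes of the loops with a given base point. They form a subgroup. -/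
def loopSubgroup {X : Type u} [TopologicalSpace X] (x : X) : AddSubgroup (H1 X) where
  carrier := Set.range (loopClass : Path x x → H1 X)
  add_mem' := by
    rintro _ _ ⟨α, rfl⟩ ⟨β, rfl⟩
    exact ⟨α.trans β, by rw [loopClass_eq, loopHom_trans]; rfl⟩
  zero_mem' := ⟨Path.refl x, by rw [loopClass_eq, loopHom_refl]; rfl⟩
  neg_mem' := by
    rintro _ ⟨α, rfl⟩
    exact ⟨α.symm, by rw [loopClass_eq, loopHom_symm]; rfl⟩

/-- The homomorphism on singular chains with given values on the singular simplices. -/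
def chainDesc {X : Type u} [TopologicalSpace X] {n : ℕ} {A : AddCommGrpCat.{u}}
    (F : (TopCat.toSSet.obj (TopCat.of X)).obj (Opposite.op (SimplexCategory.mk n)) →
      (AddCommGrpCat.of (ULift.{u} ℤ) ⟶ A)) : (singularChains X).X n ⟶ A :=
  ((TopCat.toSSet.obj (TopCat.of X)).isColimitChainComplexXCofan _ n).desc (Limits.Cofan.mk A F)

theorem ι_chainDesc {X : Type u} [TopologicalSpace X] {n : ℕ} {A : AddCommGrpCat.{u}}
    (F : (TopCat.toSSet.obj (TopCat.of X)).obj (Opposite.op (SimplexCategory.mk n)) →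
      (AddCommGrpCat.of (ULift.{u} ℤ) ⟶ A)) (s) :
    SSet.ιChainComplex _ s ≫ chainDesc F = F s :=
  ((TopCat.toSSet.obj (TopCat.of X)).isColimitChainComplexXCofan _ n).fac (Limits.Cofan.mk A F) ⟨s⟩

/-- A point, seen as a singular `0`-simplex. -/
def pointSimplex {X : Type u} [TopologicalSpace X] (x : X) :
    (TopCat.toSSet.obj (TopCat.of X)).obj (Opposite.op (SimplexCategory.mk 0)) :=
  ((TopCat.of X).toSSetObjEquiv _).symm (.const _ x)

theorem pointSimplex_injective {X : Type u} [TopologicalSpace X] :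
    Function.Injective (pointSimplex : X → _) := fun _ _ h ↦
  DFunLike.congr_fun (((TopCat.of X).toSSetObjEquiv _).symm.injective h)
    (stdSimplex.vertex (0 : Fin 1))

theorem pathSimplex_δ_zero {X : Type u} [TopologicalSpace X] {x y : X} (γ : Path x y) :
    (TopCat.toSSet.obj (TopCat.of X)).δ 0 (pathSimplex γ) = pointSimplex y := by
  apply ((TopCat.of X).toSSetObjEquiv _).injective
  ext z
  obtain rfl : z = stdSimplex.vertex 0 := Subsingleton.elim (α := stdSimplex ℝ (Fin 1)) _ _
  change γ (stdSimplexHomeomorphUnitInterval (stdSimplex.map (Fin.succAbove 0)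
    (stdSimplex.vertex 0))) = y
  rw [stdSimplex.map_vertex]
  exact γ.target

theorem pathSimplex_δ_one {X : Type u} [TopologicalSpace X] {x y : X} (γ : Path x y) :
    (TopCat.toSSet.obj (TopCat.of X)).δ 1 (pathSimplex γ) = pointSimplex x := by
  apply ((TopCat.of X).toSSetObjEquiv _).injective
  ext z
  obtain rfl : z = stdSimplex.vertex 0 := Subsingleton.elim (α := stdSimplex ℝ (Fin 1)) _ _
  change γ (stdSimplexHomeomorphUnitInterval (stdSimplex.map (Fin.succAbove 1)
    (stdSimplex.vertex 0))) = x
  rw [stdSimplex.map_vertex]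
  exact γ.source

theorem pathSimplex_d {X : Type u} [TopologicalSpace X] {x y : X} (γ : Path x y) :
    SSet.ιChainComplex (R := AddCommGrpCat.of (ULift.{u} ℤ)) _ (pathSimplex γ) ≫
      (singularChains X).d 1 0 =
        SSet.ιChainComplex _ (pointSimplex y) - SSet.ιChainComplex _ (pointSimplex x) := by
  have h := ((TopCat.toSSet.obj (TopCat.of X)).ιChainComplex_d
    (R := AddCommGrpCat.of (ULift.{u} ℤ)) (pathSimplex γ)).trans (Fin.sum_univ_two _)
  rw [pathSimplex_δ_zero, pathSimplex_δ_one] at h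
  rw [h]
  simp [sub_eq_add_neg]

theorem hom_ofULiftInt_apply {A : AddCommGrpCat.{u}} (f : AddCommGrpCat.of (ULift.{u} ℤ) ⟶ A)
    (n : ULift.{u} ℤ) : f.hom n = n.down • f.hom (ULift.up 1) := by
  rw [← map_zsmul]
  congr 1
  ext
  simp

/-- Every class in the first homology group of a path-connected space is the class of a loop with
a given base point: this is the surjectivity of the Hurewicz homomorphism. Every singular simplex
is homologous to a loop, up to the paths that join its end points to the base point, and these
paths cancel in a cycle. -/
theorem loopClass_surjective {X : Type u} [TopologicalSpace X] [PathConnectedSpace X] (x₀ : X) :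
    Function.Surjective (loopClass : Path x₀ x₀ → H1 X) := by
  let K := singularChains X
  choose x y γ hγ using exists_path_simplex (X := X)
  let l (z : X) : Path x₀ z := PathConnectedSpace.somePath x₀ z
  let Ψ : K.X 1 ⟶ K.homology 1 :=
    chainDesc fun s ↦ loopHom ((l (x s)).trans ((γ s).trans (l (y s)).symm))
  let Λ : K.X 0 ⟶ K.opcycles 1 :=
    chainDesc fun s ↦ edgeClass (l (Function.invFun pointSimplex s))
  have hΛ (z : X) : SSet.ιChainComplex _ (pointSimplex z) ≫ Λ = edgeClass (l z) := by
    rw [ι_chainDesc, Function.leftInverse_invFun pointSimplex_injective]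
  -- A simplex is, modulo boundaries, the loop through the base point minus the two joining paths,
  -- and the joining paths depend only on the boundary of the simplex.
  have h1 : K.pOpcycles 1 = Ψ ≫ K.homologyι 1 + K.d 1 0 ≫ Λ := by
    refine SSet.chainComplex_hom_ext fun s ↦ ?_
    have h2 : SSet.ιChainComplex _ s ≫ K.d 1 0 ≫ Λ = edgeClass (l (y s)) - edgeClass (l (x s)) := by
      rw [← Category.assoc, hγ s, pathSimplex_d, Preadditive.sub_comp, hΛ, hΛ, ← hγ s]
    have h3 : SSet.ιChainComplex _ s ≫ Ψ ≫ K.homologyι 1 =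
        edgeClass (l (x s)) + (edgeClass (γ s) - edgeClass (l (y s))) := by
      rw [← Category.assoc, ι_chainDesc, sub_eq_add_neg, ← edgeClass_symm, ← edgeClass_trans,
        ← edgeClass_trans]
      exact loopHom_homologyι _
    have h4 : SSet.ιChainComplex _ s ≫ K.pOpcycles 1 = edgeClass (γ s) := by
      rw [edgeClass, ← hγ s]
    rw [Preadditive.comp_add, h2, h3, h4]
    abel
  have h5 : K.homologyπ 1 = K.iCycles 1 ≫ Ψ := by
    rw [← cancel_mono (K.homologyι 1), HomologicalComplex.homology_π_ι, h1]
    simp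
  have h6 (c : K.X 1) : Ψ.hom c ∈ loopSubgroup x₀ := by
    let N : AddSubgroup (K.homology 1) := loopSubgroup x₀
    let q : K.homology 1 ⟶ AddCommGrpCat.of (K.homology 1 ⧸ N) :=
      AddCommGrpCat.ofHom (QuotientAddGroup.mk' N)
    have : Ψ ≫ q = 0 := by
      refine SSet.chainComplex_hom_ext fun s ↦ ?_
      rw [← Category.assoc, ι_chainDesc, Limits.comp_zero]
      ext n
      rw [AddCommGrpCat.hom_comp, AddMonoidHom.comp_apply, hom_ofULiftInt_apply]
      exact (QuotientAddGroup.eq_zero_iff (N := N) _).2 (N.zsmul_mem ⟨_, rfl⟩ _)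
    exact (QuotientAddGroup.eq_zero_iff (N := N) _).1 (ConcreteCategory.congr_hom this c)
  intro h
  obtain ⟨z, rfl⟩ := (AddCommGrpCat.epi_iff_surjective (K.homologyπ 1)).1 inferInstance h
  rw [h5]
  exact h6 _

/-! ### Homomorphisms from the first homology group -/

theorem eq_of_pathSimplex_eq {X : Type u} [TopologicalSpace X] {x y x' y' : X} {γ : Path x y}
    {γ' : Path x' y'} (h : pathSimplex γ = pathSimplex γ') (t : unitInterval) : γ t = γ' t := by
  have := DFunLike.congr_fun (((TopCat.of X).toSSetObjEquiv _).symm.injective h)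
    (stdSimplexHomeomorphUnitInterval.symm t)
  simpa using this

instance : ContractibleSpace (stdSimplex ℝ (Fin 3)) :=
  (convex_stdSimplex ℝ (Fin 3)).contractibleSpace ⟨_, single_mem_stdSimplex ℝ 0⟩

/-- A function on homotopy classes of paths that sends concatenation to addition induces a
homomorphism on the first homology group. -/
theorem exists_hom_of_additive_on_paths {X A : Type u} [TopologicalSpace X] [AddCommGroup A]
    (F : ∀ x y : X, Path.Homotopic.Quotient x y → A)
    (hF : ∀ x y z (α : Path.Homotopic.Quotient x y) (β : Path.Homotopic.Quotient y z),
      F x z (α.trans β) = F x y α + F y z β) :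
    ∃ Φ : H1 X →+ A, ∀ x (γ : Path x x), Φ (loopClass γ) = F x x (.mk γ) := by
  let K := singularChains X
  choose x y γ hγ using exists_path_simplex (X := X)
  let e (a : A) : AddCommGrpCat.of (ULift.{u} ℤ) ⟶ AddCommGrpCat.of A :=
    AddCommGrpCat.ofHom ((zmultiplesHom A a).comp AddEquiv.ulift.toAddMonoidHom)
  have he (a b : A) : e (a + b) = e a + e b := by
    ext n
    exact zsmul_add _ _ _
  let k : K.X 1 ⟶ AddCommGrpCat.of A := chainDesc fun s ↦ e (F _ _ (.mk (γ s)))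
  have hk {a b : X} (α : Path a b) :
      SSet.ιChainComplex _ (pathSimplex α) ≫ k = e (F a b (.mk α)) := by
    rw [ι_chainDesc]
    have h := eq_of_pathSimplex_eq (hγ (pathSimplex α))
    generalize γ (pathSimplex α) = γ' at *
    generalize x (pathSimplex α) = x' at *
    generalize y (pathSimplex α) = y' at *
    obtain rfl : a = x' := by simpa using h 0
    obtain rfl : b = y' := by simpa using h 1
    obtain rfl : α = γ' := Path.ext (funext h)
    rfl
  -- The standard `2`-simplex is simply connected, so two of its edges form a path homotopic to the
  -- third one.
  have hdk : K.d 2 1 ≫ k = 0 := by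
    refine SSet.chainComplex_hom_ext fun s ↦ ?_
    obtain ⟨m, rfl⟩ := exists_triangleSimplex s
    let e₂ : Path (triangleEdge 2 0) (triangleEdge 2 1) := ⟨triangleEdge 2, rfl, rfl⟩
    let e₀ : Path (triangleEdge 2 1) (triangleEdge 0 1) := ⟨triangleEdge 0, by
      change triangleEdge 0 0 = _
      apply stdSimplex.ext; rw [triangleEdge_two, triangleEdge_zero]; simp, rfl⟩
    let e₁ : Path (triangleEdge 2 0) (triangleEdge 0 1) := ⟨triangleEdge 1, by
      change triangleEdge 1 0 = _
      apply stdSimplex.ext; rw [triangleEdge_two, triangleEdge_one]; simp, by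
      change triangleEdge 1 1 = _
      apply stdSimplex.ext; rw [triangleEdge_zero, triangleEdge_one]; simp⟩
    have h : e (F _ _ (.mk (e₁.map m.continuous))) =
        e (F _ _ (.mk (e₂.map m.continuous))) + e (F _ _ (.mk (e₀.map m.continuous))) := by
      rw [← he, ← hF, ← Path.Homotopic.Quotient.mk_trans, ← Path.map_trans]
      congr 2
      exact Path.Homotopic.Quotient.eq.2
        ((SimplyConnectedSpace.paths_homotopic e₁ (e₂.trans e₀)).map m)
    have hd := ((TopCat.toSSet.obj (TopCat.of X)).ιChainComplex_d
      (R := AddCommGrpCat.of (ULift.{u} ℤ)) (triangleSimplex m)).trans (Fin.sum_univ_three _)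
    rw [triangleSimplex_δ m 0 (e₀.map m.continuous) fun _ ↦ rfl,
      triangleSimplex_δ m 1 (e₁.map m.continuous) fun _ ↦ rfl,
      triangleSimplex_δ m 2 (e₂.map m.continuous) fun _ ↦ rfl] at hd
    rw [← Category.assoc, Limits.comp_zero]
    refine (congrArg (· ≫ k) hd).trans ?_
    simp only [Preadditive.add_comp, Preadditive.zsmul_comp, hk, h]
    simp
  refine ⟨(K.homologyι 1 ≫ K.descOpcycles k 2 (by simp) hdk).hom, fun x γ ↦ ?_⟩
  have h : loopHom γ ≫ K.homologyι 1 ≫ K.descOpcycles k 2 (by simp) hdk = e (F x x (.mk γ)) := by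
    rw [← Category.assoc, loopHom_homologyι, edgeClass, Category.assoc,
      HomologicalComplex.p_descOpcycles, hk]
  exact (ConcreteCategory.congr_hom h (ULift.up 1)).trans (one_zsmul _)

theorem H1map_loopClass {X Y : Type u} [TopologicalSpace X] [TopologicalSpace Y] (f : C(X, Y))
    {x : X} (γ : Path x x) : H1map f (loopClass γ) = loopClass (γ.map f.continuous) := by
  have h : loopHom γ ≫ HomologicalComplex.homologyMap (SSet.chainComplexMap
      (TopCat.toSSet.map (TopCat.ofHom f)) (AddCommGrpCat.of (ULift.{u} ℤ))) 1 =
      loopHom (γ.map f.continuous) := by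
    rw [← cancel_mono ((singularChains Y).homologyι 1), loopHom_homologyι, Category.assoc,
      HomologicalComplex.homologyι_naturality, ← Category.assoc, loopHom_homologyι, edgeClass,
      Category.assoc, HomologicalComplex.p_opcyclesMap, ← Category.assoc,
      SSet.ι_chainComplexMap_f]
    rfl
  exact ConcreteCategory.congr_hom h (ULift.up 1)

/-! ### Monodromy and deck transformations -/

theorem monodromy_mk_eq_of_lift {E X : Type*} [TopologicalSpace E] [TopologicalSpace X]
    {p : E → X} (hp : IsCoveringMap p) {x y : X} (γ : Path x y) {e : p ⁻¹' {x}} {e' : p ⁻¹' {y}}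
    (Γ : Path e.1 e'.1) (h : ∀ r, p (Γ r) = γ r) : hp.monodromy (.mk γ) e = e' := by
  refine hp.monodromy_eq_of_map_eq (.mk Γ) ?_
  rw [← Path.Homotopic.Quotient.mk_map, ← Path.Homotopic.Quotient.mk_cast _ e.2 e'.2]
  exact congrArg _ (Path.ext (funext h))

theorem exists_lift_of_path {E X : Type*} [TopologicalSpace E] [TopologicalSpace X]
    {p : E → X} (hp : IsCoveringMap p) {x y : X} (γ : Path x y) (e : p ⁻¹' {x}) :
    ∃ Γ : Path e.1 (hp.monodromy (.mk γ) e).1, ∀ r, p (Γ r) = γ r :=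
  ⟨⟨hp.liftPath γ e (γ.source.trans e.2.symm), hp.liftPath_zero .., rfl⟩,
    congrFun (hp.liftPath_lifts γ e.1 (γ.source.trans e.2.symm))⟩

/-- The action of a deck transformation on a fibre. -/
def deckFiber {X Y : Type*} [TopologicalSpace X] {φ : X → Y} {y : Y} (h : deckGroup φ)
    (e : φ ⁻¹' {y}) : φ ⁻¹' {y} := ⟨h.1 e, (h.2 e).trans e.2⟩

theorem deckFiber_mul {X Y : Type*} [TopologicalSpace X] {φ : X → Y} {y : Y} (h k : deckGroup φ)
    (e : φ ⁻¹' {y}) : deckFiber (h * k) e = deckFiber h (deckFiber k e) := rfl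

theorem monodromy_deckFiber {X Y : Type*} [TopologicalSpace X] [TopologicalSpace Y] {φ : X → Y}
    (hφ : IsCoveringMap φ) {x y : Y} (γ : Path.Homotopic.Quotient x y) (h : deckGroup φ)
    (e : φ ⁻¹' {x}) : hφ.monodromy γ (deckFiber h e) = deckFiber h (hφ.monodromy γ e) := by
  obtain ⟨γ, rfl⟩ := Path.Homotopic.Quotient.mk_surjective γ
  obtain ⟨Γ, hΓ⟩ := exists_lift_of_path hφ γ e
  exact monodromy_mk_eq_of_lift hφ γ (e := deckFiber h e)
    (e' := deckFiber h (hφ.monodromy (.mk γ) e)) (Γ.map h.1.continuous)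
    fun r ↦ (h.2 _).trans (hΓ r)

theorem IsGaloisCovering.deckFiber_injective {X Y : Type*} [TopologicalSpace X]
    [TopologicalSpace Y] [PathConnectedSpace X] {φ : X → Y} (hφ : IsGaloisCovering φ) {y : Y}
    (e : φ ⁻¹' {y}) : Function.Injective fun h : deckGroup φ ↦ deckFiber h e := fun h k hk ↦
  Subtype.ext <| Homeomorph.ext <| congrFun <| hφ.isCoveringMap.eq_of_comp_eq h.1.continuous
    k.1.continuous (funext fun x ↦ (h.2 x).trans (k.2 x).symm) e.1 (congrArg Subtype.val hk)

theorem IsGaloisCovering.exists_deckFiber_eq {X Y : Type*} [TopologicalSpace X]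
    [TopologicalSpace Y] {φ : X → Y} (hφ : IsGaloisCovering φ) {y : Y}
    (e e' : φ ⁻¹' {y}) : ∃ h : deckGroup φ, deckFiber h e = e' := by
  obtain ⟨h, hh, he⟩ := hφ.exists_deck e e' (e.2.trans e'.2.symm)
  exact ⟨⟨h, hh⟩, Subtype.ext he⟩

theorem IsGaloisCovering.surjective {X Y : Type*} [TopologicalSpace X] [TopologicalSpace Y]
    [Nonempty X] [PathConnectedSpace Y] {φ : X → Y} (hφ : IsGaloisCovering φ) :
    Function.Surjective φ := fun y ↦ by
  obtain ⟨x⟩ := ‹Nonempty X›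
  exact ⟨_, (hφ.isCoveringMap.monodromy (.mk (PathConnectedSpace.somePath (φ x) y)) ⟨x, rfl⟩).2⟩

/-- The monodromy acts transitively on the fibres: the loop is the image of a path in the covering
space between the two points. -/
theorem exists_loop_monodromy_eq {X Y : Type*} [TopologicalSpace X] [TopologicalSpace Y]
    [PathConnectedSpace X] {φ : X → Y} (hφ : IsCoveringMap φ) {y : Y} (e e' : φ ⁻¹' {y}) :
    ∃ γ : Path y y, hφ.monodromy (.mk γ) e = e' :=
  let Γ := PathConnectedSpace.somePath e.1 e'.1
  ⟨(Γ.map hφ.continuous).cast e.2.symm e'.2.symm,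
    monodromy_mk_eq_of_lift hφ _ Γ fun _ ↦ rfl⟩

/-- The deck group of an inductive Galois covering is abelian: a commutator in the fundamental
group of the base lifts to a loop. -/
theorem IsGaloisCovering.deckGroup_mul_comm {X Y : Type*} [TopologicalSpace X]
    [TopologicalSpace Y] [PathConnectedSpace X] [PathConnectedSpace Y] {φ : C(X, Y)}
    (hφ : IsGaloisCovering φ) (hind : IsInductive φ) (h k : deckGroup φ) : h * k = k * h := by
  obtain ⟨x⟩ : Nonempty X := inferInstance
  let e : φ ⁻¹' {φ x} := ⟨x, rfl⟩
  let M := hφ.isCoveringMap.monodromyPerm (φ x)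
  obtain ⟨α, hα⟩ := exists_loop_monodromy_eq hφ.isCoveringMap e (deckFiber h e)
  obtain ⟨β, hβ⟩ := exists_loop_monodromy_eq hφ.isCoveringMap e (deckFiber k e)
  let a : FundamentalGroup Y (φ x) := .fromPath (.mk α)
  let b : FundamentalGroup Y (φ x) := .fromPath (.mk β)
  have hM (c : FundamentalGroup Y (φ x)) (l : deckGroup φ) (z) :
      M c (deckFiber l z) = deckFiber l (M c z) := monodromy_deckFiber _ _ _ _
  have ha : M a e = deckFiber h e := hα
  have hb : M b e = deckFiber k e := hβ
  have hab : M (a * b * a⁻¹ * b⁻¹) e = e := by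
    have hmem : a * b * a⁻¹ * b⁻¹ ∈ commutator (FundamentalGroup Y (φ x)) :=
      Subgroup.commutator_mem_commutator (Subgroup.mem_top _) (Subgroup.mem_top _)
    obtain ⟨c, -, hc⟩ := (hind.bijOn_commutator x).surjOn hmem
    rw [← hc]
    exact hφ.isCoveringMap.monodromy_map c
  apply hφ.deckFiber_injective e
  have h1 : M (a * b) e = M (b * a) e := by
    have h2 : a * b = a * b * a⁻¹ * b⁻¹ * (b * a) := by group
    -- Monodromy commutes with deck transformations, so the order of the factors is reversed.
    have h3 : M (b * a) e = deckFiber (h * k) e := by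
      rw [map_mul, Equiv.Perm.mul_apply, ha, hM, hb, deckFiber_mul]
    rw [h2, map_mul, Equiv.Perm.mul_apply, h3, hM, hab]
  rw [map_mul, map_mul, Equiv.Perm.mul_apply, Equiv.Perm.mul_apply, ha, hb, hM, hM, ha, hb,
    ← deckFiber_mul, ← deckFiber_mul] at h1
  exact h1.symm

/-- The homomorphism from the first homology group of the base of a Galois covering with abelian
deck group to the deck group: the class of a loop goes to the deck transformation that
describes its monodromy. -/
theorem IsGaloisCovering.exists_deckHom {X Y : Type u} [TopologicalSpace X]
    [TopologicalSpace Y] [PathConnectedSpace X] [PathConnectedSpace Y] {φ : C(X, Y)}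
    (hφ : IsGaloisCovering φ) (hcomm : ∀ h k : deckGroup φ, h * k = k * h) :
    ∃ Φ : H1 Y →+ Additive (deckGroup φ), ∀ y (γ : Path y y) (e : φ ⁻¹' {y}),
      hφ.isCoveringMap.monodromy (.mk γ) e = deckFiber (Φ (loopClass γ)).toMul e := by
  let _ : CommGroup (deckGroup φ) := { mul_comm := hcomm }
  -- The value of a path is the deck transformation that compares the end of its lift with the
  -- chosen point of the fibre there.
  let p (y : Y) : φ ⁻¹' {y} := ⟨_, (hφ.surjective y).choose_spec⟩
  choose F hF using fun (x y : Y) (γ : Path.Homotopic.Quotient x y) ↦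
    hφ.exists_deckFiber_eq (p y) (hφ.isCoveringMap.monodromy γ (p x))
  obtain ⟨Φ, hΦ⟩ := exists_hom_of_additive_on_paths (A := Additive (deckGroup φ))
    (fun x y γ ↦ .ofMul (F x y γ)) fun x y z α β ↦ by
      rw [← ofMul_mul]
      congr 1
      apply hφ.deckFiber_injective (p z)
      change deckFiber _ _ = deckFiber _ _
      rw [hF, hφ.isCoveringMap.monodromy_trans_apply, ← hF, monodromy_deckFiber, ← hF,
        deckFiber_mul]
  refine ⟨Φ, fun y γ e ↦ ?_⟩
  obtain ⟨h, rfl⟩ := hφ.exists_deckFiber_eq (p y) e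
  rw [hΦ, monodromy_deckFiber, ← hF, ← deckFiber_mul, ← deckFiber_mul, hcomm]
  rfl

/-- The kernel of the homomorphism to the deck group is the image of the homology of the
covering space: a loop has trivial monodromy when it lifts to a loop. -/
theorem IsGaloisCovering.deckHom_eq_zero_iff {X Y : Type u} [TopologicalSpace X]
    [TopologicalSpace Y] [PathConnectedSpace X] [PathConnectedSpace Y] {φ : C(X, Y)}
    (hφ : IsGaloisCovering φ) (Φ : H1 Y →+ Additive (deckGroup φ))
    (hΦ : ∀ y (γ : Path y y) (e : φ ⁻¹' {y}),
      hφ.isCoveringMap.monodromy (.mk γ) e = deckFiber (Φ (loopClass γ)).toMul e) (a : H1 Y) :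
    Φ a = 0 ↔ ∃ b, H1map φ b = a := by
  obtain ⟨x⟩ : Nonempty X := inferInstance
  let e : φ ⁻¹' {φ x} := ⟨x, rfl⟩
  constructor
  · intro h
    obtain ⟨α, rfl⟩ := loopClass_surjective (φ x) a
    obtain ⟨Γ, hΓ⟩ := exists_lift_of_path hφ.isCoveringMap α e
    have he : (hφ.isCoveringMap.monodromy (.mk α) e).1 = x := by
      rw [hΦ, h]
      rfl
    refine ⟨loopClass (Γ.cast rfl he.symm), ?_⟩
    rw [H1map_loopClass]
    exact congrArg _ (Path.ext (funext hΓ))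
  · rintro ⟨b, rfl⟩
    obtain ⟨β, rfl⟩ := loopClass_surjective x b
    rw [H1map_loopClass]
    apply hφ.deckFiber_injective e
    change deckFiber (Φ _).toMul e = e
    rw [← hΦ]
    exact monodromy_mk_eq_of_lift hφ.isCoveringMap _ (e := e) (e' := e) β fun _ ↦ rfl

theorem IsGaloisCovering.deckHom_surjective {X Y : Type u} [TopologicalSpace X]
    [TopologicalSpace Y] [PathConnectedSpace X] {φ : C(X, Y)}
    (hφ : IsGaloisCovering φ) (Φ : H1 Y →+ Additive (deckGroup φ))
    (hΦ : ∀ y (γ : Path y y) (e : φ ⁻¹' {y}),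
      hφ.isCoveringMap.monodromy (.mk γ) e = deckFiber (Φ (loopClass γ)).toMul e) :
    Function.Surjective Φ := fun h ↦ by
  obtain ⟨x⟩ : Nonempty X := inferInstance
  let e : φ ⁻¹' {φ x} := ⟨x, rfl⟩
  obtain ⟨γ, hγ⟩ := exists_loop_monodromy_eq hφ.isCoveringMap e (deckFiber h.toMul e)
  exact ⟨loopClass γ, hφ.deckFiber_injective e ((hΦ _ γ e).symm.trans hγ)⟩

/-! ### Monodromy of the wreath problem -/

section Wreath

variable {T T' C : Type*} {φ : T' → T} {U : Set (T × C)} {f : C}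

/-- The solution of the wreath problem given by a point above a solution. -/
def wreathSolution (s : Solutions U f) (e : φ ⁻¹' {ambientMap U s}) :
    Solutions (wreathSpace φ U) f :=
  ⟨⟨(e.1, f), by
    have h : (φ e.1, f) = s.1.1 := Prod.ext e.2 (Eq.symm s.2)
    change (φ e.1, f) ∈ U
    exact h ▸ s.1.2⟩, rfl⟩

theorem eq_of_wreathSolution_eq {s s' : Solutions U f} {e : φ ⁻¹' {ambientMap U s}}
    {e' : φ ⁻¹' {ambientMap U s'}} (h : wreathSolution s e = wreathSolution s' e') : s = s' := by
  have h1 : e.1 = e'.1 := congrArg (fun z ↦ z.1.1.1) h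
  refine Subtype.ext (Subtype.ext (Prod.ext ?_ (Eq.trans s.2 (Eq.symm s'.2))))
  exact (Eq.symm e.2).trans ((congrArg φ h1).trans e'.2)

variable [TopologicalSpace T] [TopologicalSpace T']

theorem wreathSolutionsEquiv_apply [PathConnectedSpace T'] (hφ : IsGaloisCovering φ)
    (τ : ∀ s : Solutions U f, φ ⁻¹' {ambientMap U s}) (k : deckGroup φ) (s : Solutions U f) :
    wreathSolutionsEquiv hφ τ (k, s) = wreathSolution s (deckFiber k (τ s)) := rfl

variable [TopologicalSpace C]

/-- The monodromy of the wreath problem along a loop `γ` is the monodromy of `φ` along the images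
in `T` of the lifts of `γ` to `U`. -/
theorem monodromy_wreathSolution (hφ : IsCoveringMap φ)
    (hW : IsCoveringMap (conditionMap (wreathSpace φ U))) {γ : Path f f} {s s' : Solutions U f}
    (Γ : Path s.1 s'.1) (hΓ : ∀ r, conditionMap U (Γ r) = γ r) (e : φ ⁻¹' {ambientMap U s}) :
    hW.monodromy (.mk γ) (wreathSolution s e) = wreathSolution s'
      (hφ.monodromy (.mk (Γ.map (continuous_ambientMap U))) e) := by
  obtain ⟨Δ, hΔ⟩ := exists_lift_of_path hφ (Γ.map (continuous_ambientMap U)) e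
  have h (r) : (φ (Δ r), γ r) = (Γ r).1 := Prod.ext (hΔ r) (hΓ r).symm
  refine monodromy_mk_eq_of_lift hW γ (e' := wreathSolution s' _)
    ⟨⟨fun r ↦ ⟨(Δ r, γ r), ?_⟩, ?_⟩, ?_, ?_⟩ fun _ ↦ rfl
  · change (φ (Δ r), γ r) ∈ U
    exact h r ▸ (Γ r).2
  · exact (Δ.continuous.prodMk γ.continuous).subtype_mk _
  · exact Subtype.ext (Prod.ext Δ.source γ.source)
  · exact Subtype.ext (Prod.ext Δ.target γ.target)

variable [PathConnectedSpace T']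

/-- The monodromy of the wreath problem lies in the wreath product. Deck transformations commute
with monodromy, so the monodromy multiplies `D × {s}` by an element of `D` on the right,
which is the same as on the left as `D` is abelian. -/
theorem exists_monodromy_wreathSolutionsEquiv (hφ : IsGaloisCovering φ)
    (hcomm : ∀ h k : deckGroup φ, h * k = k * h) (hU : IsCoveringMap (conditionMap U))
    (hW : IsCoveringMap (conditionMap (wreathSpace φ U)))
    (τ : ∀ s : Solutions U f, φ ⁻¹' {ambientMap U s}) (c : FundamentalGroup C f) :
    ∃ h : Solutions U f → deckGroup φ, ∀ k s,
      hW.monodromyPerm f c (wreathSolutionsEquiv hφ τ (k, s)) =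
        wreathSolutionsEquiv hφ τ (h s * k, hU.monodromyPerm f c s) := by
  obtain ⟨γ, rfl⟩ : ∃ γ : Path f f, c = .fromPath (.mk γ) :=
    ⟨_, (Path.Homotopic.Quotient.mk_surjective c.toPath).choose_spec.symm⟩
  choose Γ hΓ using exists_lift_of_path hU γ
  choose h hh using fun s : Solutions U f ↦ hφ.exists_deckFiber_eq
    (τ (hU.monodromy (.mk γ) s)) (hφ.isCoveringMap.monodromy
      (.mk ((Γ s).map (continuous_ambientMap U))) (τ s))
  refine ⟨h, fun k s ↦ ?_⟩
  rw [wreathSolutionsEquiv_apply, wreathSolutionsEquiv_apply, hcomm]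
  refine (monodromy_wreathSolution hφ.isCoveringMap hW (Γ s) (hΓ s) _).trans ?_
  rw [monodromy_deckFiber, ← hh, ← deckFiber_mul]
  rfl

/-- The Galois group of the wreath problem is the wreath product if and only if it contains the
base group `D^S` of the wreath product. -/
theorem galoisGroup_eq_wreathProduct_iff (hφ : IsGaloisCovering φ)
    (hcomm : ∀ h k : deckGroup φ, h * k = k * h) (hU : IsCoveringMap (conditionMap U))
    (hW : IsCoveringMap (conditionMap (wreathSpace φ U)))
    (τ : ∀ s : Solutions U f, φ ⁻¹' {ambientMap U s}) :
    galoisGroup hW f = (wreathProduct (deckGroup φ) (galoisGroup hU f)).map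
        (wreathSolutionsEquiv hφ τ).permCongrHom.toMonoidHom ↔
      ∀ v : Solutions U f → deckGroup φ, ∃ c, ∀ k s,
        hW.monodromyPerm f c (wreathSolutionsEquiv hφ τ (k, s)) =
          wreathSolutionsEquiv hφ τ (v s * k, s) := by
  have key (σ : Equiv.Perm (deckGroup φ × Solutions U f)) (q) :
      (wreathSolutionsEquiv hφ τ).permCongrHom.toMonoidHom σ (wreathSolutionsEquiv hφ τ q) =
        wreathSolutionsEquiv hφ τ (σ q) :=
    congrArg (fun z ↦ wreathSolutionsEquiv hφ τ (σ z)) (Equiv.symm_apply_apply _ q)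
  have ext_iff (c σ) : hW.monodromyPerm f c =
      (wreathSolutionsEquiv hφ τ).permCongrHom.toMonoidHom σ ↔
      ∀ k s, hW.monodromyPerm f c (wreathSolutionsEquiv hφ τ (k, s)) =
        wreathSolutionsEquiv hφ τ (σ (k, s)) := by
    refine ⟨fun h k s ↦ by rw [h, key], fun h ↦ Equiv.ext fun z ↦ ?_⟩
    obtain ⟨⟨k, s⟩, rfl⟩ := (wreathSolutionsEquiv hφ τ).surjective z
    rw [h, key]
  constructor
  · intro hG v
    let σ : Equiv.Perm (deckGroup φ × Solutions U f) :=
      { toFun q := (v q.2 * q.1, q.2)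
        invFun q := ((v q.2)⁻¹ * q.1, q.2)
        left_inv q := by simp
        right_inv q := by simp }
    have hσ : (wreathSolutionsEquiv hφ τ).permCongrHom.toMonoidHom σ ∈ galoisGroup hW f := by
      rw [hG]
      exact ⟨σ, ⟨1, one_mem _, v, fun _ _ ↦ rfl⟩, rfl⟩
    obtain ⟨c, hc⟩ := hσ
    exact ⟨c, (ext_iff c σ).1 hc⟩
  · intro hv
    apply le_antisymm
    · rintro _ ⟨c, rfl⟩
      obtain ⟨h, hh⟩ := exists_monodromy_wreathSolutionsEquiv hφ hcomm hU hW τ c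
      refine ⟨(wreathSolutionsEquiv hφ τ).permCongrHom.symm (hW.monodromyPerm f c),
        ⟨_, ⟨c, rfl⟩, h, fun k s ↦ ?_⟩, (MulEquiv.apply_symm_apply _ _)⟩
      apply (wreathSolutionsEquiv hφ τ).injective
      rw [← hh, ← key]
      exact DFunLike.congr_fun (MulEquiv.apply_symm_apply
        (wreathSolutionsEquiv hφ τ).permCongrHom (hW.monodromyPerm f c)) _
    · rintro _ ⟨σ, ⟨_, ⟨c, rfl⟩, h, hσ⟩, rfl⟩
      obtain ⟨h', hh'⟩ := exists_monodromy_wreathSolutionsEquiv hφ hcomm hU hW τ c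
      -- The element of `D^S` that corrects the monodromy of `c` to `σ`; it acts after `c`, so it is
      -- indexed by the images under the permutation of `S`.
      obtain ⟨b, hb⟩ := hv fun s ↦ h ((hU.monodromyPerm f c)⁻¹ s) *
        (h' ((hU.monodromyPerm f c)⁻¹ s))⁻¹
      refine ⟨b * c, (ext_iff _ σ).2 fun k s ↦ ?_⟩
      have hs : (hU.monodromyPerm f c)⁻¹ (hU.monodromyPerm f c s) = s :=
        Equiv.symm_apply_apply _ _
      rw [map_mul, Equiv.Perm.mul_apply, hh', hb, hσ, hs, ← mul_assoc, inv_mul_cancel_right]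

end Wreath

/-! ### The solution lattice -/

open scoped Pointwise in
/-- The solution lattice and `φ_* H₁(T')^d` generate `H₁(T)^d` if and only if the Galois group of
the wreath problem contains `D^S`: a loop in `C` whose lifts are closed acts on `D × {s}` by
the image in `D` of the corresponding coordinate of its vector. -/
theorem solutionLattice_add_range_eq_univ_iff {T T' : Type u} {C : Type v} [TopologicalSpace T]
    [TopologicalSpace T'] [TopologicalSpace C] [PathConnectedSpace T] [PathConnectedSpace T']
    {d : ℕ} {U : Set (T × C)} {φ : C(T', T)} (hφ : IsGaloisCovering φ)
    (hcomm : ∀ h k : deckGroup φ, h * k = k * h) (hU : IsCoveringMap (conditionMap U))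
    (hW : IsCoveringMap (conditionMap (wreathSpace φ U))) {f : C}
    (τ : ∀ s : Solutions U f, φ ⁻¹' {ambientMap U s}) (δ : Solutions U f ≃ Fin d) :
    solutionLattice U δ + Set.range (fun (b : Fin d → H1 T') i ↦ H1map φ (b i)) = Set.univ ↔
      ∀ v : Solutions U f → deckGroup φ, ∃ c, ∀ k s,
        hW.monodromyPerm f c (wreathSolutionsEquiv hφ τ (k, s)) =
          wreathSolutionsEquiv hφ τ (v s * k, s) := by
  obtain ⟨Φ, hΦ⟩ := hφ.exists_deckHom hcomm
  have hker := hφ.deckHom_eq_zero_iff Φ hΦ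
  have hmon {γ : Path f f} {s : Solutions U f} (Γ : Path s.1 s.1)
      (hΓ : ∀ r, conditionMap U (Γ r) = γ r) (k : deckGroup φ) :
      hW.monodromy (.mk γ) (wreathSolutionsEquiv hφ τ (k, s)) = wreathSolutionsEquiv hφ τ
        ((Φ (loopClass (Γ.map (continuous_ambientMap U)))).toMul * k, s) :=
    (monodromy_wreathSolution hφ.isCoveringMap hW Γ hΓ (deckFiber k (τ s))).trans
      (congrArg (wreathSolution s) (hΦ _ _ (deckFiber k (τ s))))
  constructor
  · intro h v
    choose w hw using fun i ↦ hφ.deckHom_surjective Φ hΦ (.ofMul (v (δ.symm i)))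
    obtain ⟨x, ⟨γ, Γ, hΓ, hx⟩, _, ⟨b, rfl⟩, hsum⟩ : w ∈ _ := h ▸ Set.mem_univ w
    refine ⟨.fromPath (.mk γ), fun k s ↦ (hmon (Γ s) (hΓ s) k).trans ?_⟩
    have h1 : Φ (w (δ s)) = Φ (x (δ s)) := by
      rw [← hsum]
      refine (map_add Φ _ _).trans ?_
      rw [(hker _).2 ⟨b (δ s), rfl⟩, add_zero]
    rw [← hx, ← h1, hw, Equiv.symm_apply_apply]
    rfl
  · refine fun hv ↦ Set.eq_univ_of_forall fun w ↦ ?_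
    obtain ⟨c, hc⟩ := hv fun s ↦ (Φ (w (δ s))).toMul
    obtain ⟨γ, rfl⟩ : ∃ γ : Path f f, c = .fromPath (.mk γ) :=
      ⟨_, (Path.Homotopic.Quotient.mk_surjective c.toPath).choose_spec.symm⟩
    have hlift (s : Solutions U f) : ∃ Γ : Path s.1 s.1, ∀ r, conditionMap U (Γ r) = γ r := by
      obtain ⟨Γ, hΓ⟩ := exists_lift_of_path hU γ s
      have hs : hU.monodromy (.mk γ) s = s := eq_of_wreathSolution_eq
        (e' := deckFiber ((Φ (w (δ s))).toMul * 1) (τ s)) <|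
        (monodromy_wreathSolution hφ.isCoveringMap hW Γ hΓ (deckFiber 1 (τ s))).symm.trans (hc 1 s)
      exact ⟨Γ.cast rfl (congrArg Subtype.val hs).symm, hΓ⟩
    choose Γ hΓ using hlift
    let x (i : Fin d) : H1 T := loopClass ((Γ (δ.symm i)).map (continuous_ambientMap U))
    have hx (s : Solutions U f) :
        x (δ s) = loopClass ((Γ s).map (continuous_ambientMap U)) := by
      simp only [x]
      rw [Equiv.symm_apply_apply]
    have hΦx (s : Solutions U f) : Φ (x (δ s)) = Φ (w (δ s)) := by
      have h := (wreathSolutionsEquiv hφ τ).injective ((hmon (Γ s) (hΓ s) 1).symm.trans (hc 1 s))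
      rw [hx]
      exact Additive.toMul.injective (mul_right_cancel (congrArg Prod.fst h))
    choose b hb using fun i ↦ (hker (w i - x i)).1 <| by
      rw [map_sub, ← δ.apply_symm_apply i, hΦx, sub_self]
    refine ⟨x, ⟨γ, Γ, hΓ, hx⟩, _, ⟨b, rfl⟩, funext fun i ↦ ?_⟩
    change x i + H1map φ (b i) = w i
    rw [hb, add_sub_cancel]

end

end WreathGalois

open scoped Pointwise in
theorem mainTheorem2 {T T' : Type u} {C : Type v} [TopologicalSpace T] [TopologicalSpace T']
    [TopologicalSpace C] [PathConnectedSpace T] [PathConnectedSpace T'] [ConnectedSpace C]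
    {d : ℕ} {U : Set (T × C)} (hU : WreathGalois.IsEnumerativeProblem U d)
    {φ : C(T', T)} (hφ : WreathGalois.IsGaloisCovering φ)
    (hind : WreathGalois.IsStronglyInductive φ) (f : C)
    (τ : ∀ s : WreathGalois.Solutions U f, φ ⁻¹' {WreathGalois.ambientMap U s}) :
    let Gw := WreathGalois.galoisGroup
      (WreathGalois.isCoveringMap_wreathSpace hφ.isCoveringMap hU) f
    let W := (WreathGalois.wreathProduct (WreathGalois.deckGroup φ)
      (WreathGalois.galoisGroup hU.isCoveringMap f)).map
        (WreathGalois.wreathSolutionsEquiv hφ τ).permCongrHom.toMonoidHom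
    let LatticeCondition := fun δ : WreathGalois.Solutions U f ≃ Fin d ↦
      WreathGalois.solutionLattice U δ +
        Set.range (fun (b : Fin d → WreathGalois.H1 T') i ↦ WreathGalois.H1map φ (b i)) = Set.univ
    (Gw = W ↔ ∃ δ, LatticeCondition δ) ∧ (Gw = W ↔ ∀ δ, LatticeCondition δ) := by
  intro Gw W LatticeCondition
  have hcomm := hφ.deckGroup_mul_comm hind.toIsInductive
  have hiff (δ : WreathGalois.Solutions U f ≃ Fin d) : Gw = W ↔ LatticeCondition δ :=
    (WreathGalois.galoisGroup_eq_wreathProduct_iff hφ hcomm hU.isCoveringMap _ τ).trans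
      (WreathGalois.solutionLattice_add_range_eq_univ_iff hφ hcomm hU.isCoveringMap _ τ δ).symm
  obtain ⟨δ₀⟩ : Nonempty (WreathGalois.Solutions U f ≃ Fin d) := by
    have hfin := Set.finite_of_encard_eq_coe (hU.encard_solutions f)
    have : Finite (WreathGalois.Solutions U f) := hfin
    refine ⟨Finite.equivFinOfCardEq ?_⟩
    rw [Nat.card_coe_set_eq, Set.ncard, hU.encard_solutions f]
    rfl
  exact ⟨⟨fun h ↦ ⟨δ₀, (hiff δ₀).1 h⟩, fun ⟨δ, h⟩ ↦ (hiff δ).2 h⟩,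
    ⟨fun h δ ↦ (hiff δ).1 h, fun h ↦ (hiff δ₀).2 (h δ₀)⟩⟩
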